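/- Let $X$ be a complete CAT$(-1)$ space with boundary at infinity $\partial X$ (equivalence classes of Gromov sequences). A representation $\rho : H \to \mathrm{Isom}(X)$ of a topological group $H$ is called non-elementary if it is orbitally continuous (for every $x\in X$ the map $h\mapsto \rho(h)x$ is continuous) and has no finite orbit in $X\cup\partial X$. Let $G$ be a locally compact, $\sigma$-compact Hausdorff topological group and let $\Gamma\le G$ be a lattice, that is, a discrete subgroup such that $G/\Gamma$ admits a non-zero finite $G$-invariant Radon measure. If $\rho : G\to \mathrm{Isom}(X)$ is a non-elementary representation such that $\rho|_\Gamma$ has no fixed point in $X$, then $\rho|_\Gamma : \Gamma\to\mathrm{Isom}(X)$ is a non-elementary representation. -/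

import Mathlib

open Filter Topology MeasureTheory

/-- `c`, restricted to `[0, d(x,y)]`, is a geodesic segment from `x` to `y`, parametrized by arc
length. -/
def IsGeodesicSegment {X : Type*} [MetricSpace X] (c : ℝ → X) (x y : X) : Prop :=
  c 0 = x ∧ c (dist x y) = y ∧
    ∀ s ∈ Set.Icc 0 (dist x y), ∀ t ∈ Set.Icc 0 (dist x y), dist (c s) (c t) = |s - t|

/-- Complete `CAT(-1)` spaces. The comparison plane is Mathlib's hyperbolic plane
`UpperHalfPlane` (constant curvature `-1`). In the comparison inequality, `x, y, z` are the vertices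
of a geodesic triangle, `c s` is a point of the side `[x,y]` and `c' t` is a point of the side
`[x,z]`; `x', y', z'` is a comparison triangle and `p', q'` are the comparison points. Permuting the
vertices gives all pairs of sides; for two points of one and the same side the inequality is
trivial. -/
structure IsCATNegOne (X : Type*) [MetricSpace X] : Prop where
  complete : CompleteSpace X
  geodesic : ∀ x y : X, ∃ c : ℝ → X, IsGeodesicSegment c x y
  comparison : ∀ (x y z : X) (c c' : ℝ → X),
    IsGeodesicSegment c x y → IsGeodesicSegment c' x z →
    ∀ s ∈ Set.Icc 0 (dist x y), ∀ t ∈ Set.Icc 0 (dist x z),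
    ∀ x' y' z' p' q' : UpperHalfPlane,
      dist x' y' = dist x y → dist y' z' = dist y z → dist x' z' = dist x z →
      dist x' p' = s → dist p' y' = dist x y - s →
      dist x' q' = t → dist q' z' = dist x z - t →
      dist (c s) (c' t) ≤ dist p' q'

/-- The Gromov product `(y,z)_x`. -/
noncomputable def gromovProduct {X : Type*} [MetricSpace X] (x y z : X) : ℝ :=
  (1 / 2) * (dist y x + dist z x - dist y z)

/-- `lim_{n,m → ∞} (xₙ, yₘ)_z = ∞`, with respect to any base point `z`. -/
def GromovAsymptotic {X : Type*} [MetricSpace X] (x y : ℕ → X) : Prop :=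
  ∀ z : X, Tendsto (fun p : ℕ × ℕ => gromovProduct z (x p.1) (y p.2)) atTop atTop

/-- Gromov sequences of `X`. -/
def GromovSequence (X : Type*) [MetricSpace X] : Type _ :=
  {x : ℕ → X // GromovAsymptotic x x}

/-- The boundary at infinity `∂X`: Gromov sequences up to equivalence. (`Quot` is the quotient by
the equivalence relation generated by the given relation; in a Gromov hyperbolic space, in
particular in a `CAT(-1)` space, the given relation is already an equivalence relation.) -/
def GromovBoundary (X : Type*) [MetricSpace X] : Type _ :=
  Quot (fun x y : GromovSequence X => GromovAsymptotic x.1 y.1)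

theorem GromovAsymptotic.map {X : Type*} [MetricSpace X] (f : X ≃ᵢ X) {x y : ℕ → X}
    (h : GromovAsymptotic x y) : GromovAsymptotic (fun n => f (x n)) (fun n => f (y n)) := by
  intro z
  refine (h (f.symm z)).congr fun p => ?_
  have e : ∀ a : X, dist (f a) z = dist a (f.symm z) := fun a => by
    rw [← f.dist_eq a (f.symm z), f.apply_symm_apply]
  simp [gromovProduct, e, f.dist_eq]

/-- The map `∂X → ∂X`, `[(xₙ)] ↦ [(f xₙ)]`, induced by an isometry `f` of `X`. -/
def GromovBoundary.map {X : Type*} [MetricSpace X] (f : X ≃ᵢ X) :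
    GromovBoundary X → GromovBoundary X :=
  Quot.map (fun x : GromovSequence X => ⟨fun n => f (x.1 n), x.2.map f⟩) fun _ _ h => h.map f

/-- A representation `ρ : G → Isom(X)` is non-elementary if it is orbitally continuous and has no
finite orbit in `X ∪ ∂X`. -/
structure IsNonElementary {G X : Type*} [Group G] [TopologicalSpace G] [MetricSpace X]
    (ρ : G →* (X ≃ᵢ X)) : Prop where
  orbitallyContinuous : ∀ x : X, Continuous fun g : G => ρ g x
  infinite_orbit : ∀ x : X, (Set.range fun g : G => ρ g x).Infinite
  infinite_orbit_boundary :
    ∀ ξ : GromovBoundary X, (Set.range fun g : G => GromovBoundary.map (ρ g) ξ).Infinite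

/-- A lattice in `G`: a discrete subgroup `Γ` such that `G ⧸ Γ` carries a non-zero finite
`G`-invariant Radon measure (a regular measure on the Borel `σ`-algebra). -/
def IsLatticeSubgroup {G : Type*} [Group G] [TopologicalSpace G] (Γ : Subgroup G) : Prop :=
  DiscreteTopology Γ ∧
    letI : MeasurableSpace (G ⧸ Γ) := borel (G ⧸ Γ)
    ∃ μ : Measure (G ⧸ Γ), μ ≠ 0 ∧ IsFiniteMeasure μ ∧ μ.Regular ∧ SMulInvariantMeasure G (G ⧸ Γ) μ

/-!
A `Γ`-orbit that is finite in `X` has a circumcenter, which `Γ` would fix. So the point is to exclude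
a finite `Γ`-orbit `F` in `∂X`.

Suppose that `F` is finite and `Γ`-invariant, and let `μ` be the invariant finite measure on `G ⧸ Γ`.
The function `A ↦ μ {gΓ | gF meets A}` (`hitSet`) on subsets of `∂X` is monotone, subadditive and
`G`-invariant; call it the mass of `A`. Fix a quarter `c` of the total mass, and for an integer `n`
let `T n` be the set of the points `x ∈ X` such that no unit ball contains the `n`-th points of the
rays from `x` to a set of boundary points of mass larger than `c`. It is `G`-invariant.

* Each `T n` is bounded. If `x` and `x'` are far apart, every boundary point is seen from `x` in the
  direction of `x'` or from `x'` in the direction of `x` (`exists_shadow_cover`), so if both are in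
  `T n` the total mass is at most `2c`.
* If some `T n` is nonempty, its circumcenter is fixed by `G` (`IsCATNegOne.exists_forall_fixed`),
  which contradicts that `ρ` is non-elementary.
* If all `T n` are empty, the rays from a base point to a set of mass at least `c` are close to each
  other up to distance `n`, for every `n`. As `μ` is finite, a limsup argument yields a boundary point
  of mass at least `c` (`exists_le_measure_hitSet_singleton`). The set of all points of
  mass at least `c` is finite (`finite_setOf_le_measure_hitSet`) and `G`-invariant, again a contradiction.

Measurability is no problem, as `g ↦` (the `n`-th point of the ray from `o` to `gξ`) is continuous on
`G` (`continuous_boundaryRay_map`). All the geometry comes from the hyperbolic Stewart inequality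
`IsCATNegOne.sinh_mul_cosh_dist_le`. Applied twice, it bounds the distance between points on two
geodesics issuing from one point (`IsCATNegOne.sinh_mul_sinh_mul_le`), which gives the rays, their
uniqueness and their divergence. Applied to midpoints, it gives circumcenters.
-/

/-! ### Stewart's identity in the hyperbolic plane -/

/-- The point `i eʳ` of the upper half plane; `r ↦ i eʳ` is a unit speed geodesic. -/
noncomputable def verticalPoint (r : ℝ) : UpperHalfPlane :=
  ⟨⟨0, Real.exp r⟩, Real.exp_pos r⟩

theorem dist_verticalPoint (r s : ℝ) : dist (verticalPoint r) (verticalPoint s) = |r - s| := by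
  have h : (verticalPoint r).re = (verticalPoint s).re := rfl
  rw [UpperHalfPlane.dist_of_re_eq h]
  change dist (Real.log (Real.exp r)) (Real.log (Real.exp s)) = _
  rw [Real.log_exp, Real.log_exp, Real.dist_eq]

theorem cosh_dist_verticalPoint (r : ℝ) (z : UpperHalfPlane) :
    Real.cosh (dist (verticalPoint r) z) =
      (z.re ^ 2 + z.im ^ 2 + Real.exp r ^ 2) / (2 * z.im * Real.exp r) := by
  have hz := z.im_pos
  have hr := Real.exp_pos r
  have him : (verticalPoint r).im = Real.exp r := rfl
  have h1 : (↑(verticalPoint r) : ℂ) = ⟨0, Real.exp r⟩ := rfl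
  rw [UpperHalfPlane.cosh_dist, Complex.dist_eq, Complex.sq_norm, Complex.normSq_apply, him, h1]
  simp only [Complex.sub_re, Complex.sub_im, UpperHalfPlane.coe_re, UpperHalfPlane.coe_im]
  field_simp
  ring

theorem sinh_mul_cosh_dist_verticalPoint (a s : ℝ) (z : UpperHalfPlane) :
    Real.sinh a * Real.cosh (dist (verticalPoint s) z) =
      Real.sinh (a - s) * Real.cosh (dist (verticalPoint 0) z) +
        Real.sinh s * Real.cosh (dist (verticalPoint a) z) := by
  have hz := z.im_pos
  have hs := Real.exp_pos s
  have ha := Real.exp_pos a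
  simp only [cosh_dist_verticalPoint, Real.sinh_eq, neg_sub, Real.exp_sub, Real.exp_neg,
    Real.exp_zero]
  field_simp
  ring

/-- Existence of comparison triangles, with one side on the imaginary axis. -/
theorem exists_dist_verticalPoint {a b c : ℝ} (ha : 0 < a) (hb : 0 ≤ b) (hc : 0 ≤ c)
    (h₁ : |a - b| ≤ c) (h₂ : c ≤ a + b) :
    ∃ z, dist (verticalPoint 0) z = b ∧ dist (verticalPoint a) z = c := by
  have hab : 0 ≤ a + b := by linarith
  have hC₁ : Real.cosh (a - b) ≤ Real.cosh c :=
    Real.cosh_le_cosh.2 (by rwa [abs_of_nonneg hc])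
  have hC₂ : Real.cosh c ≤ Real.cosh (a + b) :=
    Real.cosh_le_cosh.2 (by rwa [abs_of_nonneg hc, abs_of_nonneg hab])
  set C := Real.cosh c with hC
  have hB := Real.cosh_eq b
  set B := Real.cosh b with hB'
  have hA : 1 < Real.exp a := Real.one_lt_exp_iff.2 ha
  have hE := Real.exp_pos b
  rw [Real.cosh_eq, neg_sub, Real.exp_sub, Real.exp_sub] at hC₁
  rw [Real.cosh_eq, neg_add, Real.exp_add, Real.exp_add, Real.exp_neg, Real.exp_neg] at hC₂
  rw [Real.exp_neg] at hB
  set A := Real.exp a with hAdef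
  set E := Real.exp b with hEdef
  have hA0 : 0 < A := by linarith
  have e1 : A ^ 2 + E ^ 2 ≤ 2 * A * E * C := by
    have : (A / E + E / A) / 2 * (2 * A * E) ≤ C * (2 * A * E) := by gcongr
    have e : (A / E + E / A) / 2 * (2 * A * E) = A ^ 2 + E ^ 2 := by field_simp
    linarith
  have e2 : 2 * A * E * C ≤ A ^ 2 * E ^ 2 + 1 := by
    have : C * (2 * A * E) ≤ (A * E + A⁻¹ * E⁻¹) / 2 * (2 * A * E) := by gcongr
    have e : (A * E + A⁻¹ * E⁻¹) / 2 * (2 * A * E) = A ^ 2 * E ^ 2 + 1 := by field_simp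
    linarith
  have e3 : 2 * E * B = E ^ 2 + 1 := by rw [hB]; field_simp
  have hD : 0 < A * C - B := by
    have : 0 < 2 * E * (A * C - B) := by nlinarith
    exact pos_of_mul_pos_right this (by positivity)
  set D := A * C - B with hDdef
  set v := (A ^ 2 - 1) / (2 * D) with hv
  have hv0 : 0 < v := div_pos (by nlinarith) (by positivity)
  have hvD : v * (2 * D) = A ^ 2 - 1 := div_mul_cancel₀ _ (by positivity)
  have v1 : v ≤ E := by
    rw [hv, div_le_iff₀ (by positivity)]; nlinarith
  have v2 : 1 ≤ v * E := by
    have : 2 * D ≤ (A ^ 2 - 1) * E := by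
      have : E * (2 * D) ≤ E * ((A ^ 2 - 1) * E) := by nlinarith
      exact le_of_mul_le_mul_left this hE
    have h : 1 * (2 * D) ≤ v * E * (2 * D) := by nlinarith
    exact le_of_mul_le_mul_right h (by positivity)
  have hu : 0 ≤ 2 * v * B - v ^ 2 - 1 := by
    have : 0 ≤ E * (2 * v * B - v ^ 2 - 1) := by
      have : E * (2 * v * B - v ^ 2 - 1) = (E - v) * (v * E - 1) := by linear_combination v * e3
      rw [this]
      exact mul_nonneg (by linarith) (by linarith)
    exact nonneg_of_mul_nonneg_right this hE
  let z : UpperHalfPlane := ⟨⟨√(2 * v * B - v ^ 2 - 1), v⟩, hv0⟩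
  have hz1 : z.re = √(2 * v * B - v ^ 2 - 1) := rfl
  have hz2 : z.im = v := rfl
  have inj : ∀ {p q : ℝ}, 0 ≤ p → 0 ≤ q → Real.cosh p = Real.cosh q → p = q :=
    fun hp hq h => Real.cosh_strictMonoOn.injOn hp hq h
  refine ⟨z, inj dist_nonneg hb ?_, inj dist_nonneg hc ?_⟩
  · rw [cosh_dist_verticalPoint, hz1, hz2, Real.sq_sqrt hu, Real.exp_zero, ← hB']
    field_simp
    ring
  · rw [cosh_dist_verticalPoint, hz1, hz2, Real.sq_sqrt hu, ← hC, ← hAdef,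
      div_eq_iff (by positivity)]
    linear_combination -hvD + 2 * v * hDdef

/-! ### Comparison inequalities in `CAT(-1)` spaces -/

section CAT

variable {X : Type*} [MetricSpace X]

theorem IsGeodesicSegment.dist_left {c : ℝ → X} {x y : X} (h : IsGeodesicSegment c x y) {s : ℝ}
    (hs : s ∈ Set.Icc 0 (dist x y)) : dist x (c s) = s := by
  have := h.2.2 0 ⟨le_rfl, dist_nonneg⟩ s hs
  rwa [h.1, zero_sub, abs_neg, abs_of_nonneg hs.1] at this

theorem IsGeodesicSegment.dist_right {c : ℝ → X} {x y : X} (h : IsGeodesicSegment c x y) {s : ℝ}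
    (hs : s ∈ Set.Icc 0 (dist x y)) : dist (c s) y = dist x y - s := by
  have := h.2.2 s hs (dist x y) ⟨dist_nonneg, le_rfl⟩
  rwa [h.2.1, abs_sub_comm, abs_of_nonneg (by linarith [hs.2])] at this

/-- The hyperbolic Stewart inequality. All the geometry below is derived from it. -/
theorem IsCATNegOne.sinh_mul_cosh_dist_le (hX : IsCATNegOne X) {x y : X} (z : X) {c : ℝ → X}
    (hc : IsGeodesicSegment c x y) {s : ℝ} (hs : s ∈ Set.Icc 0 (dist x y)) :
    Real.sinh (dist x y) * Real.cosh (dist (c s) z) ≤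
      Real.sinh (dist x y - s) * Real.cosh (dist x z) + Real.sinh s * Real.cosh (dist y z) := by
  rcases (dist_nonneg (x := x) (y := y)).eq_or_lt with h0 | hpos
  · have hs0 : s = 0 := le_antisymm (by rw [h0]; exact hs.2) hs.1
    simp [← h0, hs0]
  obtain ⟨z', hz₁, hz₂⟩ := exists_dist_verticalPoint (b := dist x z) (c := dist y z) hpos
    dist_nonneg dist_nonneg
    (by rw [abs_le]; constructor <;>
          linarith [dist_triangle x y z, dist_triangle x z y, dist_comm y z])
    (by linarith [dist_triangle_left y z x])
  obtain ⟨c', hc'⟩ := hX.geodesic x z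
  have key := hX.comparison x y z c c' hc hc' s hs (dist x z) ⟨dist_nonneg, le_rfl⟩
    (verticalPoint 0) (verticalPoint (dist x y)) z' (verticalPoint s) z'
    (by rw [dist_verticalPoint, zero_sub, abs_neg, abs_of_pos hpos]) hz₂ hz₁
    (by rw [dist_verticalPoint, zero_sub, abs_neg, abs_of_nonneg hs.1])
    (by rw [dist_verticalPoint, abs_sub_comm, abs_of_nonneg (by linarith [hs.2])])
    hz₁ (by rw [dist_self, sub_self])
  rw [hc'.2.1] at key
  rw [← hz₁, ← hz₂, ← sinh_mul_cosh_dist_verticalPoint]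
  refine mul_le_mul_of_nonneg_left (Real.cosh_le_cosh.2 ?_) (Real.sinh_nonneg_iff.2 dist_nonneg)
  rwa [abs_of_nonneg dist_nonneg, abs_of_nonneg dist_nonneg]

/-- Comparison of the points at the same distance `s` from `x` on two sides of a triangle. -/
theorem IsCATNegOne.sinh_mul_sinh_mul_le (hX : IsCATNegOne X) {x y z : X} {c c' : ℝ → X}
    (hc : IsGeodesicSegment c x y) (hc' : IsGeodesicSegment c' x z) {s : ℝ} (hs : 0 ≤ s)
    (hy : s ≤ dist x y) (hz : s ≤ dist x z) :
    Real.sinh (dist x y) * Real.sinh (dist x z) * (Real.cosh (dist (c s) (c' s)) - 1) ≤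
      Real.sinh s ^ 2 * (Real.cosh (dist y z) - Real.cosh (dist x y - dist x z)) := by
  have h₁ := hX.sinh_mul_cosh_dist_le z hc ⟨hs, hy⟩
  have h₂ := hX.sinh_mul_cosh_dist_le (c s) hc' ⟨hs, hz⟩
  rw [hc.dist_left ⟨hs, hy⟩, dist_comm z, dist_comm (c' s)] at h₂
  set a := dist x y
  set b := dist x z
  have ha : 0 ≤ Real.sinh a := Real.sinh_nonneg_iff.2 dist_nonneg
  have hss : 0 ≤ Real.sinh s := Real.sinh_nonneg_iff.2 hs
  have h₃ := mul_le_mul_of_nonneg_left h₂ ha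
  have h₄ := mul_le_mul_of_nonneg_left h₁ hss
  have hcs := Real.cosh_sq s
  rw [Real.sinh_sub] at h₃ h₄
  rw [Real.cosh_sub]
  linear_combination h₃ + h₄ + Real.sinh a * Real.sinh b * hcs

end CAT

/-! ### Geodesics -/

section Geod

variable {X : Type*} [MetricSpace X]

theorem eq_of_cosh_dist_le_one {x y : X} (h : Real.cosh (dist x y) ≤ 1) : x = y := by
  by_contra hne
  exact absurd h (not_le.2 (Real.one_lt_cosh.2 (dist_pos.2 hne).ne'))

theorem IsCATNegOne.geodesicSegment_unique (hX : IsCATNegOne X) {x y : X} {c c' : ℝ → X}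
    (hc : IsGeodesicSegment c x y) (hc' : IsGeodesicSegment c' x y) {s : ℝ}
    (hs : s ∈ Set.Icc 0 (dist x y)) : c s = c' s := by
  rcases (dist_nonneg (x := x) (y := y)).eq_or_lt with h0 | hpos
  · have hs0 : s = 0 := le_antisymm (by rw [h0]; exact hs.2) hs.1
    rw [hs0, hc.1, hc'.1]
  have key := hX.sinh_mul_sinh_mul_le hc hc' hs.1 hs.2 hs.2
  rw [dist_self, sub_self, Real.cosh_zero, sub_self, mul_zero] at key
  have h2 := Real.sinh_pos_iff.2 hpos
  apply eq_of_cosh_dist_le_one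
  have := nonpos_of_mul_nonpos_right key (mul_pos h2 h2)
  linarith

/-- `geod hX x y s` is the point at distance `s` from `x` on the geodesic segment from `x` to
`y`; only the values for `0 ≤ s ≤ d(x,y)` are meaningful. -/
noncomputable def geod (hX : IsCATNegOne X) (x y : X) : ℝ → X :=
  (hX.geodesic x y).choose

variable (hX : IsCATNegOne X)

theorem isGeodesicSegment_geod (x y : X) : IsGeodesicSegment (geod hX x y) x y :=
  (hX.geodesic x y).choose_spec

theorem dist_geod_left {x y : X} {s : ℝ} (hs : 0 ≤ s) (h : s ≤ dist x y) :
    dist x (geod hX x y s) = s :=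
  (isGeodesicSegment_geod hX x y).dist_left ⟨hs, h⟩

theorem dist_geod_right {x y : X} {s : ℝ} (hs : 0 ≤ s) (h : s ≤ dist x y) :
    dist (geod hX x y s) y = dist x y - s :=
  (isGeodesicSegment_geod hX x y).dist_right ⟨hs, h⟩

theorem geod_geod {x y : X} {s t : ℝ} (hs : 0 ≤ s) (hst : s ≤ t) (ht : t ≤ dist x y) :
    geod hX x (geod hX x y t) s = geod hX x y s := by
  have hd := dist_geod_left hX (hs.trans hst) ht
  refine hX.geodesicSegment_unique (isGeodesicSegment_geod hX x _) ⟨?_, ?_, ?_⟩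
    ⟨hs, by rwa [hd]⟩
  · exact (isGeodesicSegment_geod hX x y).1
  · rw [hd]
  · rw [hd]
    intro u hu v hv
    exact (isGeodesicSegment_geod hX x y).2.2 u ⟨hu.1, hu.2.trans ht⟩ v ⟨hv.1, hv.2.trans ht⟩

theorem map_geod (f : X ≃ᵢ X) {x y : X} {s : ℝ} (hs : 0 ≤ s) (h : s ≤ dist x y) :
    f (geod hX x y s) = geod hX (f x) (f y) s := by
  have hg := isGeodesicSegment_geod hX x y
  refine (hX.geodesicSegment_unique (c' := fun s => f (geod hX x y s))
    (isGeodesicSegment_geod hX (f x) (f y)) ⟨?_, ?_, ?_⟩ ⟨hs, by rwa [f.dist_eq]⟩).symm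
  · change f (geod hX x y 0) = f x
    rw [hg.1]
  · change f (geod hX x y (dist (f x) (f y))) = f y
    rw [f.dist_eq, hg.2.1]
  · simpa only [f.dist_eq] using hg.2.2

theorem geod_symm {x y : X} {s : ℝ} (hs : 0 ≤ s) (h : s ≤ dist x y) :
    geod hX y x (dist x y - s) = geod hX x y s := by
  have hg := isGeodesicSegment_geod hX y x
  refine (hX.geodesicSegment_unique (c' := fun s => geod hX y x (dist x y - s))
    (isGeodesicSegment_geod hX x y) ⟨?_, ?_, ?_⟩ ⟨hs, h⟩).symm
  · change geod hX y x (dist x y - 0) = x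
    rw [sub_zero, dist_comm, hg.2.1]
  · change geod hX y x (dist x y - dist x y) = y
    rw [sub_self, hg.1]
  · intro u hu v hv
    rw [hg.2.2, abs_sub_comm]
    · ring_nf
    · rw [dist_comm]; exact ⟨by linarith [hu.2], by linarith [hu.1]⟩
    · rw [dist_comm]; exact ⟨by linarith [hv.2], by linarith [hv.1]⟩

theorem sinh_mul_sinh_mul_geod_le {x y z : X} {s : ℝ} (hs : 0 ≤ s)
    (hy : s ≤ dist x y) (hz : s ≤ dist x z) :
    Real.sinh (dist x y) * Real.sinh (dist x z) *
        (Real.cosh (dist (geod hX x y s) (geod hX x z s)) - 1) ≤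
      Real.sinh s ^ 2 * (Real.cosh (dist y z) - Real.cosh (dist x y - dist x z)) :=
  hX.sinh_mul_sinh_mul_le (isGeodesicSegment_geod hX x y) (isGeodesicSegment_geod hX x z) hs hy hz

/-- Two geodesics from the same point diverge at least as fast as in the hyperbolic plane. -/
theorem sinh_sq_mul_geod_le {x y z : X} {s t : ℝ} (hs : 0 ≤ s) (hst : s ≤ t)
    (hy : t ≤ dist x y) (hz : t ≤ dist x z) :
    Real.sinh t ^ 2 * (Real.cosh (dist (geod hX x y s) (geod hX x z s)) - 1) ≤
      Real.sinh s ^ 2 * (Real.cosh (dist (geod hX x y t) (geod hX x z t)) - 1) := by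
  have ht := hs.trans hst
  have hy' := dist_geod_left hX ht hy
  have hz' := dist_geod_left hX ht hz
  have key := sinh_mul_sinh_mul_geod_le hX hs (hst.trans_eq hy'.symm) (hst.trans_eq hz'.symm)
  rw [geod_geod hX hs hst hy, geod_geod hX hs hst hz, hy', hz', sub_self, Real.cosh_zero] at key
  linarith

/-- Two geodesics from `x` to `y` and to `z` stay close as long as the Gromov product `(y,z)_x`
has not been reached. -/
theorem dist_geod_le_exp {x y z : X} {s : ℝ} (hs : 0 ≤ s) (hy : s ≤ dist x y) (hz : s ≤ dist x z)
    (hy1 : 1 ≤ dist x y) (hz1 : 1 ≤ dist x z) :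
    dist (geod hX x y s) (geod hX x z s) ≤
      6 * Real.sinh s * Real.exp (-gromovProduct x y z) := by
  have key := sinh_mul_sinh_mul_geod_le hX hs hy hz
  set d := dist (geod hX x y s) (geod hX x z s) with hd
  have hd0 : 0 ≤ d := dist_nonneg
  have hsinh : ∀ a : ℝ, 1 ≤ a → Real.exp a / 4 ≤ Real.sinh a := fun a ha => by
    have h1 : Real.exp (-a) ≤ 1 := Real.exp_le_one_iff.2 (by linarith)
    have h2 := Real.add_one_le_exp a
    rw [Real.sinh_eq]
    linarith
  have hcosh : Real.cosh (dist y z) ≤ Real.exp (dist y z) := by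
    have : Real.exp (-dist y z) ≤ Real.exp (dist y z) :=
      Real.exp_le_exp.2 (by linarith [dist_nonneg (x := y) (y := z)])
    rw [Real.cosh_eq]
    linarith
  have hdc : d ^ 2 / 2 ≤ Real.cosh d - 1 := by
    have h1 := Real.cosh_sq (d / 2)
    have h2 := Real.cosh_two_mul (d / 2)
    rw [mul_div_cancel₀ d two_ne_zero] at h2
    have h3 : (d / 2) ^ 2 ≤ Real.sinh (d / 2) ^ 2 := by
      gcongr
      exact Real.self_le_sinh_iff.2 (by positivity)
    linarith
  have hA := hsinh _ hy1
  have hB := hsinh _ hz1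
  have hss : 0 ≤ Real.sinh s := Real.sinh_nonneg_iff.2 hs
  have h1 : Real.exp (dist x y) / 4 * (Real.exp (dist x z) / 4) * (d ^ 2 / 2) ≤
      Real.sinh s ^ 2 * Real.exp (dist y z) :=
    calc _ ≤ Real.sinh (dist x y) * Real.sinh (dist x z) * (Real.cosh d - 1) := by gcongr
      _ ≤ _ := key
      _ ≤ _ := by
        gcongr
        linarith [Real.cosh_pos (dist x y - dist x z)]
  have h2 : Real.exp (-gromovProduct x y z) ^ 2 * (Real.exp (dist x y) * Real.exp (dist x z)) =
      Real.exp (dist y z) := by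
    rw [sq, ← Real.exp_add, ← Real.exp_add, ← Real.exp_add, gromovProduct, dist_comm x y,
      dist_comm x z]
    ring_nf
  refine abs_le_of_sq_le_sq' ?_ (by positivity) |>.2
  have hP : 0 < Real.exp (dist x y) * Real.exp (dist x z) := by positivity
  refine le_of_mul_le_mul_right ?_ hP
  have h3 : 0 ≤ Real.sinh s ^ 2 * Real.exp (dist y z) := by positivity
  calc d ^ 2 * (Real.exp (dist x y) * Real.exp (dist x z))
      ≤ 36 * (Real.sinh s ^ 2 * Real.exp (dist y z)) := by linarith
    _ = _ := by rw [← h2]; ring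

/-- Seen from `y`, the two points lie on the geodesics to `x` and `x'`, at distances from `y` that
differ by at most `d(x,x')`; points at equal distance from `y` are at most `d(x,x')` apart. -/
theorem dist_geod_basepoint_of_le {x x' y : X} {s : ℝ} (hs : 0 ≤ s) (hx : s ≤ dist x y)
    (hxx : dist x y ≤ dist x' y) :
    dist (geod hX x y s) (geod hX x' y s) ≤ 2 * dist x x' := by
  rcases hx.eq_or_lt with hx0 | hx0
  · have h1 := (isGeodesicSegment_geod hX x y).2.1
    rw [← hx0] at h1
    rw [h1, dist_comm, dist_geod_right hX hs (hx.trans hxx)]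
    linarith [dist_triangle x' x y, dist_comm x x', dist_nonneg (x := x) (y := x')]
  have hr : 0 ≤ dist x y - s := by linarith
  have key := sinh_mul_sinh_mul_geod_le hX (x := y) (y := x) (z := x') hr
    (by rw [dist_comm y]; linarith) (by rw [dist_comm y]; linarith)
  rw [geod_symm hX hs hx] at key
  set p := geod hX x y s
  set q := geod hX y x' (dist x y - s) with hq
  have hpos : 0 < dist x y := by linarith
  have ha : 0 < Real.sinh (dist y x) := by rw [dist_comm]; exact Real.sinh_pos_iff.2 hpos
  have hab : Real.sinh (dist y x) ≤ Real.sinh (dist y x') := by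
    rw [dist_comm y, dist_comm y]; exact Real.sinh_le_sinh.2 hxx
  have hra : Real.sinh (dist x y - s) ≤ Real.sinh (dist y x) := by
    rw [dist_comm y]; exact Real.sinh_le_sinh.2 (by linarith)
  have hr0 : 0 ≤ Real.sinh (dist x y - s) := Real.sinh_nonneg_iff.2 hr
  have h1 : Real.sinh (dist y x) * Real.sinh (dist y x') * (Real.cosh (dist p q) - 1) ≤
      Real.sinh (dist y x) * Real.sinh (dist y x') * (Real.cosh (dist x x') - 1) :=
    calc _ ≤ _ := key
      _ ≤ Real.sinh (dist x y - s) ^ 2 * (Real.cosh (dist x x') - 1) := by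
        gcongr
        exact Real.one_le_cosh _
      _ ≤ _ := by
        have h0 : 0 ≤ Real.cosh (dist x x') - 1 := by linarith [Real.one_le_cosh (dist x x')]
        rw [sq]
        gcongr
        exact hra.trans hab
  have h2 : Real.cosh (dist p q) ≤ Real.cosh (dist x x') := by
    have := le_of_mul_le_mul_left h1 (mul_pos ha (ha.trans_le hab))
    linarith
  have h3 : dist p q ≤ dist x x' := by
    rwa [Real.cosh_le_cosh, abs_of_nonneg dist_nonneg, abs_of_nonneg dist_nonneg] at h2
  have h4 : dist q (geod hX x' y s) = dist x' y - dist x y := by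
    rw [← geod_symm hX hs (hx.trans hxx), hq, (isGeodesicSegment_geod hX y x').2.2, abs_sub_comm]
    · rw [abs_of_nonneg (by linarith)]; ring
    · rw [dist_comm y]; exact ⟨hr, by linarith⟩
    · rw [dist_comm y]; exact ⟨by linarith, by linarith⟩
  linarith [dist_triangle p q (geod hX x' y s), dist_triangle x' x y, dist_comm x x']

theorem dist_geod_basepoint {x x' y : X} {s : ℝ} (hs : 0 ≤ s) (hx : s ≤ dist x y)
    (hx' : s ≤ dist x' y) :
    dist (geod hX x y s) (geod hX x' y s) ≤ 2 * dist x x' := by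
  rcases le_total (dist x y) (dist x' y) with h | h
  · exact dist_geod_basepoint_of_le hX hs hx h
  · rw [dist_comm, dist_comm x]
    exact dist_geod_basepoint_of_le hX hs hx' h

/-! ### Circumcenters -/

theorem IsCATNegOne.exists_midpoint (hX : IsCATNegOne X) (x y : X) :
    ∃ m, ∀ z, 2 * Real.cosh (dist x y / 2) * Real.cosh (dist m z) ≤
      Real.cosh (dist x z) + Real.cosh (dist y z) := by
  rcases (dist_nonneg (x := x) (y := y)).eq_or_lt with h0 | hpos
  · refine ⟨x, fun z => ?_⟩
    rw [← dist_eq_zero.1 h0.symm, dist_self, zero_div, Real.cosh_zero]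
    linarith
  refine ⟨geod hX x y (dist x y / 2), fun z => ?_⟩
  have h := hX.sinh_mul_cosh_dist_le z (isGeodesicSegment_geod hX x y)
    (s := dist x y / 2) ⟨by positivity, by linarith⟩
  have h2 := Real.sinh_two_mul (dist x y / 2)
  rw [mul_div_cancel₀ _ two_ne_zero] at h2
  rw [sub_half, h2] at h
  refine le_of_mul_le_mul_left ?_ (Real.sinh_pos_iff.2 (half_pos hpos))
  linarith

/-- A nonempty bounded set has a circumcenter, which is fixed by every isometry preserving the
set. In the midpoint inequality, the factor `cosh (d(x,y)/2)` makes minimizing sequences Cauchy. -/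
theorem IsCATNegOne.exists_forall_fixed (hX : IsCATNegOne X) {S : Set X} (hne : S.Nonempty)
    (hb : Bornology.IsBounded S) :
    ∃ x, ∀ f : X ≃ᵢ X, Set.MapsTo f.symm S S → f x = x := by
  have := hX.complete
  obtain ⟨a₀, ha₀⟩ := hne
  -- `T` consists of the numbers `cosh r`, for the balls of radius `r` containing `S`.
  set T : Set ℝ := {t | ∃ x, ∀ a ∈ S, Real.cosh (dist x a) ≤ t} with hT
  have hT1 : ∀ t ∈ T, 1 ≤ t := fun t ⟨x, hx⟩ => (Real.one_le_cosh _).trans (hx a₀ ha₀)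
  have hTb : BddBelow T := ⟨1, hT1⟩
  have hTne : T.Nonempty := by
    obtain ⟨C, hC⟩ := Metric.isBounded_iff.1 hb
    refine ⟨Real.cosh C, a₀, fun a ha => Real.cosh_le_cosh.2 ?_⟩
    rw [abs_of_nonneg dist_nonneg]
    exact (hC ha₀ ha).trans (le_abs_self _)
  set I := sInf T with hI
  have hI1 : 1 ≤ I := le_csInf hTne hT1
  have close : ∀ {x y : X} {t : ℝ}, (∀ a ∈ S, Real.cosh (dist x a) ≤ t) →
      (∀ a ∈ S, Real.cosh (dist y a) ≤ t) → Real.cosh (dist x y / 2) * I ≤ t := by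
    intro x y t hx hy
    obtain ⟨m, hm⟩ := hX.exists_midpoint x y
    have hc := Real.cosh_pos (dist x y / 2)
    rw [mul_comm, ← le_div_iff₀ hc]
    refine csInf_le hTb ⟨m, fun a ha => ?_⟩
    rw [le_div_iff₀ hc]
    linarith [hm a, hx a ha, hy a ha]
  have hex : ∀ n : ℕ, ∃ x, ∀ a ∈ S, Real.cosh (dist x a) ≤ I + 1 / ((n : ℝ) + 1) := fun n => by
    obtain ⟨t, ⟨x, hx⟩, ht⟩ := exists_lt_of_csInf_lt hTne
      (lt_add_of_pos_right I (Nat.one_div_pos_of_nat (n := n) (α := ℝ)))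
    exact ⟨x, fun a ha => (hx a ha).trans ht.le⟩
  choose x hx using hex
  have hmono : ∀ {N n : ℕ}, N ≤ n → ∀ a ∈ S, Real.cosh (dist (x n) a) ≤ I + 1 / ((N : ℝ) + 1) :=
    fun h a ha => (hx _ a ha).trans (by gcongr)
  have hcau : CauchySeq x := by
    rw [Metric.cauchySeq_iff]
    intro ε hε
    have h1 : 0 < Real.cosh (ε / 2) - 1 := by
      linarith [Real.one_lt_cosh.2 (half_pos hε).ne']
    obtain ⟨N, hN⟩ := exists_nat_one_div_lt h1
    refine ⟨N, fun m hm n hn => ?_⟩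
    have h2 := close (hmono hm) (hmono hn)
    have h3 : Real.cosh (dist (x m) (x n) / 2) < Real.cosh (ε / 2) := by
      nlinarith [Real.one_le_cosh (dist (x m) (x n) / 2)]
    rw [Real.cosh_lt_cosh, abs_of_nonneg (by positivity), abs_of_pos (by positivity)] at h3
    linarith
  obtain ⟨p, hp⟩ := cauchySeq_tendsto_of_complete hcau
  have hpI : ∀ a ∈ S, Real.cosh (dist p a) ≤ I := fun a ha => by
    have l1 : Tendsto (fun n => Real.cosh (dist (x n) a)) atTop (𝓝 (Real.cosh (dist p a))) :=
      (Real.continuous_cosh.tendsto _).comp (hp.dist tendsto_const_nhds)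
    have l2 : Tendsto (fun n : ℕ => I + 1 / ((n : ℝ) + 1)) atTop (𝓝 (I + 0)) :=
      tendsto_const_nhds.add tendsto_one_div_add_atTop_nhds_zero_nat
    rw [add_zero] at l2
    exact le_of_tendsto_of_tendsto' l1 l2 fun n => hx n a ha
  refine ⟨p, fun f hf => ?_⟩
  have hfp : ∀ a ∈ S, Real.cosh (dist (f p) a) ≤ I := fun a ha => by
    rw [← f.apply_symm_apply a, f.dist_eq]
    exact hpI _ (hf ha)
  have h := close hfp hpI
  have h1 : Real.cosh (dist (f p) p / 2) ≤ 1 := by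
    refine le_of_mul_le_mul_right (a := I) ?_ (by linarith)
    linarith
  by_contra hne
  exact absurd h1 (not_le.2 (Real.one_lt_cosh.2 (half_pos (dist_pos.2 hne)).ne'))

end Geod

/-! ### Rays towards the boundary at infinity -/

section Boundary

variable {X : Type*} [MetricSpace X]

theorem GromovAsymptotic.tendsto_dist {x : ℕ → X} (h : GromovAsymptotic x x) (o : X) :
    Tendsto (fun n => dist o (x n)) atTop atTop := by
  refine ((h o).comp tendsto_atTop_diagonal).congr fun n => ?_
  simp only [Function.comp, gromovProduct, dist_self, dist_comm o]
  ring

variable (hX : IsCATNegOne X)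

theorem GromovAsymptotic.tendsto_dist_geod {x y : ℕ → X} (hx : GromovAsymptotic x x)
    (hy : GromovAsymptotic y y) (hxy : GromovAsymptotic x y) (o : X) {s : ℝ} (hs : 0 ≤ s) :
    Tendsto (fun p : ℕ × ℕ => dist (geod hX o (x p.1) s) (geod hX o (y p.2) s)) atTop (𝓝 0) := by
  have h1 : Tendsto (fun p : ℕ × ℕ => 6 * Real.sinh s *
      Real.exp (-gromovProduct o (x p.1) (y p.2))) atTop (𝓝 (6 * Real.sinh s * 0)) :=
    ((Real.tendsto_exp_neg_atTop_nhds_zero).comp (hxy o)).const_mul _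
  rw [mul_zero] at h1
  have hxl := ((hx.tendsto_dist o).eventually_ge_atTop (max s 1))
  have hyl := ((hy.tendsto_dist o).eventually_ge_atTop (max s 1))
  refine squeeze_zero' (Eventually.of_forall fun _ => dist_nonneg) ?_ h1
  rw [← prod_atTop_atTop_eq]
  filter_upwards [hxl.prod_mk hyl] with p hp
  exact dist_geod_le_exp hX hs ((le_max_left _ _).trans hp.1) ((le_max_left _ _).trans hp.2)
    ((le_max_right _ _).trans hp.1) ((le_max_right _ _).trans hp.2)

theorem GromovSequence.exists_tendsto_geod (x : GromovSequence X) (o : X) {s : ℝ} (hs : 0 ≤ s) :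
    ∃ p, Tendsto (fun n => geod hX o (x.1 n) s) atTop (𝓝 p) := by
  have := hX.complete
  exact cauchySeq_tendsto_of_complete
    (cauchySeq_iff_tendsto_dist_atTop_0.2 (x.2.tendsto_dist_geod hX x.2 x.2 o hs))

/-- `boundaryRay hX o ξ n` is the point at distance `n` from `o` on the geodesic ray from `o` to
the boundary point `ξ = [(xₖ)]`, that is, the limit of the points at distance `n` from `o` on the
geodesics from `o` to `xₖ`. Only
integers `n ≥ 0` are admitted as distances, because the limit has no meaning for negative ones. -/
noncomputable def boundaryRay (o : X) (ξ : GromovBoundary X) (n : ℕ) : X :=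
  Quot.lift (fun x : GromovSequence X =>
      (x.exists_tendsto_geod hX o (Nat.cast_nonneg n)).choose)
    (fun x y h => by
      have hx := (x.exists_tendsto_geod hX o (Nat.cast_nonneg n)).choose_spec
      have hy := (y.exists_tendsto_geod hX o (Nat.cast_nonneg n)).choose_spec
      have h0 := (x.2.tendsto_dist_geod hX y.2 h o (Nat.cast_nonneg n)).comp
        tendsto_atTop_diagonal
      exact dist_eq_zero.1 (tendsto_nhds_unique (hx.dist hy) h0)) ξ

theorem tendsto_boundaryRay (o : X) (x : GromovSequence X) (n : ℕ) :
    Tendsto (fun k => geod hX o (x.1 k) n) atTop (𝓝 (boundaryRay hX o (Quot.mk _ x) n)) :=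
  (x.exists_tendsto_geod hX o (Nat.cast_nonneg n)).choose_spec

theorem map_boundaryRay (f : X ≃ᵢ X) (o : X) (ξ : GromovBoundary X) (n : ℕ) :
    f (boundaryRay hX o ξ n) = boundaryRay hX (f o) (GromovBoundary.map f ξ) n := by
  obtain ⟨x, rfl⟩ := Quot.exists_rep ξ
  have h1 := (f.continuous.tendsto _).comp (tendsto_boundaryRay hX o x n)
  have h2 := tendsto_boundaryRay hX (f o) ⟨fun k => f (x.1 k), x.2.map f⟩ n
  refine tendsto_nhds_unique h1 (h2.congr' ?_)
  filter_upwards [(x.2.tendsto_dist o).eventually_ge_atTop (n : ℝ)] with k hk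
  exact (map_geod hX f (Nat.cast_nonneg n) hk).symm

theorem dist_boundaryRay_basepoint (o o' : X) (ξ : GromovBoundary X) (n : ℕ) :
    dist (boundaryRay hX o ξ n) (boundaryRay hX o' ξ n) ≤ 2 * dist o o' := by
  obtain ⟨x, rfl⟩ := Quot.exists_rep ξ
  refine le_of_tendsto ((tendsto_boundaryRay hX o x n).dist (tendsto_boundaryRay hX o' x n)) ?_
  filter_upwards [(x.2.tendsto_dist o).eventually_ge_atTop (n : ℝ),
    (x.2.tendsto_dist o').eventually_ge_atTop (n : ℝ)] with k hk hk'
  exact dist_geod_basepoint hX (Nat.cast_nonneg n) hk hk'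

theorem sinh_sq_mul_boundaryRay_le (o : X) (ξ η : GromovBoundary X) {m n : ℕ} (hmn : m ≤ n) :
    Real.sinh n ^ 2 * (Real.cosh (dist (boundaryRay hX o ξ m) (boundaryRay hX o η m)) - 1) ≤
      Real.sinh m ^ 2 *
        (Real.cosh (dist (boundaryRay hX o ξ n) (boundaryRay hX o η n)) - 1) := by
  obtain ⟨x, rfl⟩ := Quot.exists_rep ξ
  obtain ⟨y, rfl⟩ := Quot.exists_rep η
  have lim : ∀ k : ℕ, Tendsto
      (fun i => Real.cosh (dist (geod hX o (x.1 i) k) (geod hX o (y.1 i) k)) - 1) atTop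
      (𝓝 (Real.cosh (dist (boundaryRay hX o (Quot.mk _ x) k)
        (boundaryRay hX o (Quot.mk _ y) k)) - 1)) := fun k =>
    ((Real.continuous_cosh.tendsto _).comp
      ((tendsto_boundaryRay hX o x k).dist (tendsto_boundaryRay hX o y k))).sub_const 1
  refine le_of_tendsto_of_tendsto ((lim m).const_mul _) ((lim n).const_mul _) ?_
  filter_upwards [(x.2.tendsto_dist o).eventually_ge_atTop (n : ℝ),
    (y.2.tendsto_dist o).eventually_ge_atTop (n : ℝ)] with k hk hk'
  exact sinh_sq_mul_geod_le hX (Nat.cast_nonneg m) (by exact_mod_cast hmn) hk hk'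

theorem dist_boundaryRay_mono (o : X) (ξ η : GromovBoundary X) :
    Monotone fun n => dist (boundaryRay hX o ξ n) (boundaryRay hX o η n) := by
  intro m n hmn
  rcases hmn.eq_or_lt with rfl | hlt
  · rfl
  have key := sinh_sq_mul_boundaryRay_le hX o ξ η hmn
  have hn : 0 < Real.sinh n := Real.sinh_pos_iff.2 (by exact_mod_cast (Nat.zero_le m).trans_lt hlt)
  have hm : 0 ≤ Real.sinh m := Real.sinh_nonneg_iff.2 (Nat.cast_nonneg m)
  have hmn' : Real.sinh m ≤ Real.sinh n := Real.sinh_le_sinh.2 (by exact_mod_cast hmn)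
  set d := dist (boundaryRay hX o ξ m) (boundaryRay hX o η m) with hd
  set d' := dist (boundaryRay hX o ξ n) (boundaryRay hX o η n) with hd'
  have h1 : Real.sinh n ^ 2 * (Real.cosh d - 1) ≤ Real.sinh n ^ 2 * (Real.cosh d' - 1) := by
    refine key.trans ?_
    have := Real.one_le_cosh d'
    gcongr
  have h2 : Real.cosh d ≤ Real.cosh d' := by
    have := le_of_mul_le_mul_left h1 (by positivity)
    linarith
  rwa [Real.cosh_le_cosh, abs_of_nonneg dist_nonneg, abs_of_nonneg dist_nonneg] at h2

theorem eq_of_boundaryRay_eq (o : X) {ξ η : GromovBoundary X}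
    (h : ∀ n, boundaryRay hX o ξ n = boundaryRay hX o η n) : ξ = η := by
  obtain ⟨x, rfl⟩ := Quot.exists_rep ξ
  obtain ⟨y, rfl⟩ := Quot.exists_rep η
  refine Quot.sound fun z => tendsto_atTop.2 fun b => ?_
  obtain ⟨n, hn⟩ := exists_nat_ge (b + 1 + dist o z)
  have ev : ∀ w : GromovSequence X, boundaryRay hX o (Quot.mk _ w) n =
      boundaryRay hX o (Quot.mk _ y) n → ∀ᶠ k in atTop, (n : ℝ) ≤ dist o (w.1 k) ∧
        dist (geod hX o (w.1 k) n) (boundaryRay hX o (Quot.mk _ y) n) < 1 := fun w hw => by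
    have hl := tendsto_boundaryRay hX o w n
    rw [hw] at hl
    exact ((w.2.tendsto_dist o).eventually_ge_atTop (n : ℝ)).and
      (hl.eventually (Metric.ball_mem_nhds _ one_pos))
  rw [← prod_atTop_atTop_eq]
  filter_upwards [(ev x (h n)).prod_mk (ev y rfl)] with p hp
  obtain ⟨⟨h1, h2⟩, h3, h4⟩ := hp
  have e1 := dist_geod_right hX (Nat.cast_nonneg n) h1
  have e2 := dist_geod_right hX (Nat.cast_nonneg n) h3
  have t1 := dist_triangle_left (x.1 p.1) (y.1 p.2) (geod hX o (x.1 p.1) n)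
  have t2 := dist_triangle (geod hX o (x.1 p.1) n) (geod hX o (y.1 p.2) n) (y.1 p.2)
  have t3 := dist_triangle_right (geod hX o (x.1 p.1) n) (geod hX o (y.1 p.2) n)
    (boundaryRay hX o (Quot.mk _ y) n)
  have t4 := dist_triangle o z (x.1 p.1)
  have t5 := dist_triangle o z (y.1 p.2)
  rw [gromovProduct, dist_comm _ z, dist_comm _ z]
  linarith

/-- Two rays from `o` that stay close to each other are equal. -/
theorem eq_of_dist_boundaryRay_lt (o : X) {ξ η : GromovBoundary X} {C : ℝ}
    (h : ∀ n, dist (boundaryRay hX o ξ n) (boundaryRay hX o η n) < C) : ξ = η := by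
  refine eq_of_boundaryRay_eq hX o fun m => eq_of_cosh_dist_le_one ?_
  set d := Real.cosh (dist (boundaryRay hX o ξ m) (boundaryRay hX o η m)) - 1 with hd
  have hd0 : 0 ≤ d := by linarith [Real.one_le_cosh (dist (boundaryRay hX o ξ m)
    (boundaryRay hX o η m))]
  suffices d ≤ 0 by linarith
  by_contra! hpos
  obtain ⟨n, hn⟩ := exists_nat_ge (max (m : ℝ) (Real.sinh m ^ 2 * (Real.cosh C - 1) / d + 1))
  have hmn : m ≤ n := by exact_mod_cast (le_max_left _ _).trans hn
  have hn2 := (le_max_right _ _).trans hn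
  have hC1 : 0 ≤ Real.cosh C - 1 := by linarith [Real.one_le_cosh C]
  have hn1 : (1 : ℝ) ≤ n := by
    have : 0 ≤ Real.sinh m ^ 2 * (Real.cosh C - 1) / d := by positivity
    linarith
  have key := sinh_sq_mul_boundaryRay_le hX o ξ η hmn
  have hlt : Real.cosh (dist (boundaryRay hX o ξ n) (boundaryRay hX o η n)) ≤ Real.cosh C :=
    Real.cosh_le_cosh.2 (by
      rw [abs_of_nonneg dist_nonneg]; exact (h n).le.trans (le_abs_self C))
  have h1 : (n : ℝ) ≤ Real.sinh n := Real.self_le_sinh_iff.2 (Nat.cast_nonneg n)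
  have h2 : (n : ℝ) ≤ Real.sinh n ^ 2 := by nlinarith
  have h3 : (n : ℝ) * d ≤ Real.sinh m ^ 2 * (Real.cosh C - 1) :=
    calc (n : ℝ) * d ≤ Real.sinh n ^ 2 * d := by gcongr
      _ ≤ _ := key
      _ ≤ _ := by gcongr
  rw [← le_div_iff₀ hpos] at h3
  linarith

/-- If `x` and `x'` are far apart, then every boundary point is seen from `x` in the direction of
`x'`, or from `x'` in the direction of `x`: the sum of the Gromov products `(y,x')_x` and
`(y,x)_{x'}` is `d(x,x')`, so one of the two is large. -/
theorem exists_shadow_cover (n : ℕ) : ∃ L : ℝ, ∀ x x' : X, L ≤ dist x x' →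
    ∀ ξ : GromovBoundary X, dist (boundaryRay hX x ξ n) (geod hX x x' n) < 1 ∨
      dist (boundaryRay hX x' ξ n) (geod hX x' x n) < 1 := by
  have hlim : Tendsto (fun L : ℝ => 6 * Real.sinh n * Real.exp (-(L / 2))) atTop
      (𝓝 (6 * Real.sinh n * 0)) :=
    (Real.tendsto_exp_neg_atTop_nhds_zero.comp (tendsto_id.atTop_div_const two_pos)).const_mul _
  rw [mul_zero] at hlim
  obtain ⟨L, hL, hLn, hL1⟩ := ((hlim.eventually_le_const (show (0 : ℝ) < 1 / 2 by norm_num)).and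
    ((eventually_ge_atTop (n : ℝ)).and (eventually_ge_atTop (1 : ℝ)))).exists
  have hsinh : 0 ≤ Real.sinh n := Real.sinh_nonneg_iff.2 (Nat.cast_nonneg n)
  refine ⟨L, fun x x' hxx ξ => ?_⟩
  obtain ⟨u, rfl⟩ := Quot.exists_rep ξ
  have one : ∀ v v' : X, L ≤ dist v v' → (∃ᶠ k in atTop, L / 2 ≤ gromovProduct v (u.1 k) v') →
      dist (boundaryRay hX v (Quot.mk _ u) n) (geod hX v v' n) < 1 := by
    intro v v' hv hfr
    have l := (tendsto_boundaryRay hX v u n).dist (tendsto_const_nhds (x := geod hX v v' n))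
    refine lt_of_le_of_lt (le_of_tendsto_of_frequently l ?_) (show (1 / 2 : ℝ) < 1 by norm_num)
    refine (hfr.and_eventually
      (((u.2.tendsto_dist v).eventually_ge_atTop (n : ℝ)).and
        ((u.2.tendsto_dist v).eventually_ge_atTop 1))).mono fun k ⟨h1, h2, h3⟩ => ?_
    refine (dist_geod_le_exp hX (Nat.cast_nonneg n) h2 (hLn.trans hv) h3 (hL1.trans hv)).trans
      (le_trans ?_ hL)
    gcongr
  have hor : ∃ᶠ k in atTop, (L / 2 ≤ gromovProduct x (u.1 k) x' ∨
      L / 2 ≤ gromovProduct x' (u.1 k) x) := by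
    refine Frequently.of_forall fun k => ?_
    by_contra! hcon
    obtain ⟨h1, h2⟩ := hcon
    rw [gromovProduct] at h1 h2
    linarith [dist_comm x x']
  rcases frequently_or_distrib.1 hor with h | h
  · exact Or.inl (one x x' hxx h)
  · exact Or.inr (one x' x (by rwa [dist_comm]) h)

theorem GromovBoundary.map_one (ξ : GromovBoundary X) :
    GromovBoundary.map (1 : X ≃ᵢ X) ξ = ξ := by
  obtain ⟨x, rfl⟩ := Quot.exists_rep ξ
  rfl

theorem GromovBoundary.map_mul (f g : X ≃ᵢ X) (ξ : GromovBoundary X) :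
    GromovBoundary.map (f * g) ξ = GromovBoundary.map f (GromovBoundary.map g ξ) := by
  obtain ⟨x, rfl⟩ := Quot.exists_rep ξ
  rfl

theorem continuous_boundaryRay_map {G : Type*} [Group G] [TopologicalSpace G]
    [IsTopologicalGroup G] (ρ : G →* (X ≃ᵢ X)) (hρ : ∀ x : X, Continuous fun g => ρ g x) (o : X)
    (ξ : GromovBoundary X) (n : ℕ) :
    Continuous fun g => boundaryRay hX o (GromovBoundary.map (ρ g) ξ) n := by
  have e : ∀ g, boundaryRay hX o (GromovBoundary.map (ρ g) ξ) n =
      ρ g (boundaryRay hX (ρ g⁻¹ o) ξ n) := fun g => by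
    have h1 : ρ g (ρ g⁻¹ o) = o := by
      rw [← IsometryEquiv.mul_apply, ← MonoidHom.map_mul, mul_inv_cancel, MonoidHom.map_one]
      rfl
    rw [map_boundaryRay, h1]
  simp only [e]
  rw [continuous_iff_continuousAt]
  intro h
  rw [ContinuousAt, tendsto_iff_dist_tendsto_zero]
  set w := boundaryRay hX (ρ h⁻¹ o) ξ n with hw
  have l1 : Tendsto (fun g => 2 * dist (ρ g⁻¹ o) (ρ h⁻¹ o) + dist (ρ g w) (ρ h w)) (𝓝 h)
      (𝓝 (2 * 0 + 0)) := by
    refine Tendsto.add (Tendsto.const_mul _ ?_) ?_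
    · exact tendsto_iff_dist_tendsto_zero.1 (((hρ o).comp continuous_inv).tendsto h)
    · exact tendsto_iff_dist_tendsto_zero.1 ((hρ w).tendsto h)
  rw [mul_zero, add_zero] at l1
  refine squeeze_zero (fun _ => dist_nonneg) (fun g => ?_) l1
  refine (dist_triangle _ (ρ g w) _).trans (add_le_add_left ?_ _)
  rw [(ρ g).dist_eq]
  exact dist_boundaryRay_basepoint hX _ _ _ _

end Boundary

/-! ### The translates of a finite set over a homogeneous space of finite volume -/

section Hit

variable {G B : Type*} [Group G] [MulAction G B]

/-- The set of cosets `gΓ` such that `gF` meets `A`, for a `Γ`-invariant set `F`. If `μ` is an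
invariant measure on `G ⧸ Γ`, then `A ↦ μ (hitSet Γ F A)` plays the role of a `G`-invariant measure
on `B`. -/
def hitSet (Γ : Subgroup G) (F A : Set B) : Set (G ⧸ Γ) :=
  {q | ∃ g : G, (g : G ⧸ Γ) = q ∧ ∃ b ∈ F, g • b ∈ A}

variable {Γ : Subgroup G} {F : Set B}

theorem hitSet_mono {A A' : Set B} (h : A ⊆ A') : hitSet Γ F A ⊆ hitSet Γ F A' :=
  fun _ ⟨g, hg, b, hb, hA⟩ => ⟨g, hg, b, hb, h hA⟩

theorem hitSet_union (A A' : Set B) : hitSet Γ F (A ∪ A') ⊆ hitSet Γ F A ∪ hitSet Γ F A' := by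
  rintro _ ⟨g, hg, b, hb, h | h⟩
  · exact Or.inl ⟨g, hg, b, hb, h⟩
  · exact Or.inr ⟨g, hg, b, hb, h⟩

theorem hitSet_univ (hF : F.Nonempty) : hitSet Γ F Set.univ = Set.univ := by
  obtain ⟨b, hb⟩ := hF
  refine Set.eq_univ_of_forall fun q => ?_
  obtain ⟨g, rfl⟩ := QuotientGroup.mk_surjective q
  exact ⟨g, rfl, b, hb, trivial⟩

theorem mk_mem_hitSet (hF : ∀ γ ∈ Γ, ∀ b ∈ F, γ • b ∈ F) {A : Set B} {g : G} :
    (g : G ⧸ Γ) ∈ hitSet Γ F A ↔ ∃ b ∈ F, g • b ∈ A := by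
  refine ⟨fun ⟨g', hg', b, hb, hA⟩ => ?_, fun h => ⟨g, rfl, h⟩⟩
  refine ⟨(g⁻¹ * g') • b, hF _ (QuotientGroup.eq.1 hg'.symm) b hb, ?_⟩
  rwa [smul_smul, mul_inv_cancel_left]

theorem preimage_smul_hitSet (k : G) (A : Set B) :
    (fun q : G ⧸ Γ => k • q) ⁻¹' hitSet Γ F A = hitSet Γ F {b | k • b ∈ A} := by
  ext q
  constructor
  · rintro ⟨g, hg, b, hb, hA⟩
    refine ⟨k⁻¹ * g, ?_, b, hb, ?_⟩
    · change k⁻¹ • (g : G ⧸ Γ) = q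
      rw [hg, inv_smul_smul]
    · rwa [Set.mem_ofPred_eq, smul_smul, mul_inv_cancel_left]
  · rintro ⟨g, rfl, b, hb, hA⟩
    exact ⟨k * g, rfl, b, hb, by rwa [mul_smul]⟩

variable [TopologicalSpace G]

theorem isOpen_hitSet (hF : ∀ γ ∈ Γ, ∀ b ∈ F, γ • b ∈ F) {A : Set B}
    (hA : ∀ b ∈ F, IsOpen {g : G | g • b ∈ A}) : IsOpen (hitSet Γ F A) := by
  have hq : IsQuotientMap (QuotientGroup.mk : G → G ⧸ Γ) :=
    QuotientGroup.isQuotientMap_mk Γ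
  rw [← hq.isOpen_preimage]
  have : (QuotientGroup.mk : G → G ⧸ Γ) ⁻¹' hitSet Γ F A = ⋃ b ∈ F, {g : G | g • b ∈ A} := by
    ext g
    simp [mk_mem_hitSet hF]
  rw [this]
  exact isOpen_biUnion hA

theorem isClosed_hitSet (hF : ∀ γ ∈ Γ, ∀ b ∈ F, γ • b ∈ F) (hfin : F.Finite) {A : Set B}
    (hA : ∀ b ∈ F, IsClosed {g : G | g • b ∈ A}) : IsClosed (hitSet Γ F A) := by
  have hq : IsQuotientMap (QuotientGroup.mk : G → G ⧸ Γ) :=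
    QuotientGroup.isQuotientMap_mk Γ
  rw [← hq.isClosed_preimage]
  have : (QuotientGroup.mk : G → G ⧸ Γ) ⁻¹' hitSet Γ F A = ⋃ b ∈ F, {g : G | g • b ∈ A} := by
    ext g
    simp [mk_mem_hitSet hF]
  rw [this]
  exact hfin.isClosed_biUnion hA

end Hit

section Measure

variable {G B : Type*} [Group G] [MulAction G B] {Γ : Subgroup G} {F : Set B}
  [MeasurableSpace (G ⧸ Γ)] {μ : Measure (G ⧸ Γ)}

/-- There are only finitely many points `b` such that `{b}` has mass at least `c`, because every
coset `gΓ` contributes to at most `|F|` of these masses. -/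
theorem finite_setOf_le_measure_hitSet [IsFiniteMeasure μ]
    (hF : ∀ γ ∈ Γ, ∀ b ∈ F, γ • b ∈ F) (hfin : F.Finite)
    (hmeas : ∀ b : B, MeasurableSet (hitSet Γ F {b})) {c : ENNReal} (hc : c ≠ 0) :
    {b : B | c ≤ μ (hitSet Γ F {b})}.Finite := by
  classical
  by_contra hinf
  obtain ⟨N, hN⟩ := ENNReal.exists_nat_mul_gt hc
    (ENNReal.mul_ne_top (ENNReal.natCast_ne_top hfin.toFinset.card) (measure_ne_top μ Set.univ))
  obtain ⟨T, hT, hTN⟩ := Set.Infinite.exists_subset_card_eq hinf N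
  have h1 : (N : ENNReal) * c ≤ ∑ b ∈ T, μ (hitSet Γ F {b}) := by
    rw [← hTN, ← nsmul_eq_mul]
    exact Finset.card_nsmul_le_sum T _ _ fun b hb => hT hb
  have h2 : ∑ b ∈ T, μ (hitSet Γ F {b}) ≤ hfin.toFinset.card * μ Set.univ := by
    calc ∑ b ∈ T, μ (hitSet Γ F {b})
        = ∑ b ∈ T, ∫⁻ q, (hitSet Γ F {b}).indicator 1 q ∂μ :=
          Finset.sum_congr rfl fun b _ => (lintegral_indicator_one (hmeas b)).symm
      _ = ∫⁻ q, ∑ b ∈ T, (hitSet Γ F {b}).indicator 1 q ∂μ :=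
          (lintegral_finsetSum _ fun b _ => measurable_one.indicator (hmeas b)).symm
      _ ≤ ∫⁻ _, (hfin.toFinset.card : ENNReal) ∂μ := by
          refine lintegral_mono fun q => ?_
          obtain ⟨g, rfl⟩ := QuotientGroup.mk_surjective q
          simp only [Set.indicator_apply, Pi.one_apply, mk_mem_hitSet hF, Finset.sum_boole]
          norm_cast
          refine (Finset.card_le_card fun b hb => ?_).trans
            (Finset.card_image_le (s := hfin.toFinset) (f := fun b => g • b))
          obtain ⟨-, b', hb', hgb⟩ := Finset.mem_filter.1 hb
          exact Finset.mem_image.2 ⟨b', hfin.mem_toFinset.2 hb', hgb⟩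
      _ = _ := lintegral_const _
  exact absurd (h1.trans h2) (not_le.2 hN)

theorem Set.Finite.exists_frequently {α ι : Type*} {s : Set α} (hs : s.Finite) {l : Filter ι}
    {p : α → ι → Prop} (h : ∃ᶠ i in l, ∃ a ∈ s, p a i) : ∃ a ∈ s, ∃ᶠ i in l, p a i := by
  by_contra! hcon
  refine h ?_
  have := hs.eventually_all.2 fun a ha => hcon a ha
  filter_upwards [this] with i hi ⟨a, ha, hpa⟩ using hi a ha hpa

/-- If sets `W n` of mass at least `c` shrink to points, in the sense that `W n ⊆ U n b` whenever
`b ∈ W n`, where the sets `U n b` decrease to `{b}`, then there is an atom of mass at least `c`. -/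
theorem exists_le_measure_hitSet_singleton [IsFiniteMeasure μ]
    (hF : ∀ γ ∈ Γ, ∀ b ∈ F, γ • b ∈ F) (hfin : F.Finite)
    {c : ENNReal} (hc : c ≠ 0) (W : ℕ → Set B) (U : ℕ → B → Set B)
    (hW : ∀ n, MeasurableSet (hitSet Γ F (W n))) (hWc : ∀ n, c ≤ μ (hitSet Γ F (W n)))
    (hU : ∀ n b, MeasurableSet (hitSet Γ F (U n b))) (hUanti : ∀ b, Antitone fun n => U n b)
    (hUb : ∀ b b', (∀ n, b' ∈ U n b) → b' = b) (hWU : ∀ n, ∀ b ∈ W n, W n ⊆ U n b) :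
    ∃ b, c ≤ μ (hitSet Γ F {b}) := by
  -- By finiteness of `μ`, some coset `gΓ` lies in infinitely many of the sets `hitSet Γ F (W n)`.
  have hlim : c ≤ μ (⋂ n, ⋃ k ≥ n, hitSet Γ F (W k)) := by
    have h := tendsto_measure_iInter_atTop (μ := μ) (s := fun n => ⋃ k ≥ n, hitSet Γ F (W k))
      (fun n => (MeasurableSet.iUnion fun k => MeasurableSet.iUnion fun _ =>
        hW k).nullMeasurableSet)
      (fun m n hmn => Set.biUnion_subset_biUnion_left fun k hk => hmn.trans hk)
      ⟨0, measure_ne_top _ _⟩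
    exact ge_of_tendsto' h fun n => (hWc n).trans
      (measure_mono (Set.subset_biUnion_of_mem (u := fun k => hitSet Γ F (W k)) (le_refl n)))
  obtain ⟨q, hq⟩ := nonempty_of_measure_ne_zero
    (ne_of_gt ((pos_iff_ne_zero.2 hc).trans_le hlim))
  obtain ⟨g, rfl⟩ := QuotientGroup.mk_surjective q
  have hfr : ∃ᶠ n in atTop, ∃ b ∈ F, g • b ∈ W n := by
    rw [frequently_atTop]
    intro n
    obtain ⟨k, hk, hk'⟩ := Set.mem_iUnion₂.1 (Set.mem_iInter.1 hq n)
    exact ⟨k, hk, (mk_mem_hitSet hF).1 hk'⟩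
  obtain ⟨b, -, hb⟩ := hfin.exists_frequently hfr
  refine ⟨g • b, ?_⟩
  have hanti : Antitone fun n => hitSet Γ F (U n (g • b)) :=
    fun m n hmn => hitSet_mono (hUanti _ hmn)
  have hUc : ∀ n, c ≤ μ (hitSet Γ F (U n (g • b))) := fun n => by
    obtain ⟨k, hk, hk'⟩ := frequently_atTop.1 hb n
    exact (hWc k).trans (measure_mono ((hitSet_mono (hWU k _ hk')).trans (hanti hk)))
  have h := tendsto_measure_iInter_atTop (μ := μ) (fun n => (hU n (g • b)).nullMeasurableSet)
    hanti ⟨0, measure_ne_top _ _⟩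
  refine (ge_of_tendsto' h hUc).trans (measure_mono fun q hq => ?_)
  obtain ⟨g', rfl⟩ := QuotientGroup.mk_surjective q
  have hfr' : ∃ᶠ n in atTop, ∃ b' ∈ F, g' • b' ∈ U n (g • b) :=
    (Eventually.of_forall fun n => (mk_mem_hitSet hF).1 (Set.mem_iInter.1 hq n)).frequently
  obtain ⟨b', hb'F, hb'⟩ := hfin.exists_frequently hfr'
  refine (mk_mem_hitSet hF).2 ⟨b', hb'F, hUb _ _ fun n => ?_⟩
  obtain ⟨k, hk, hk'⟩ := frequently_atTop.1 hb' n
  exact hUanti _ hk hk'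

end Measure

/-! ### Non-elementarity of the restriction -/

/-- The action of `G` on the boundary at infinity defined by a representation. -/
abbrev boundaryAction {G X : Type*} [Group G] [MetricSpace X] (ρ : G →* (X ≃ᵢ X)) :
    MulAction G (GromovBoundary X) where
  smul g ξ := GromovBoundary.map (ρ g) ξ
  one_smul ξ := by
    change GromovBoundary.map (ρ 1) ξ = ξ
    rw [MonoidHom.map_one, GromovBoundary.map_one]
  mul_smul g h ξ := by
    change GromovBoundary.map (ρ (g * h)) ξ =
      GromovBoundary.map (ρ g) (GromovBoundary.map (ρ h) ξ)
    rw [MonoidHom.map_mul, GromovBoundary.map_mul]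

/-- A subgroup of finite covolume has no finite orbit at infinity. -/
theorem IsNonElementary.infinite_orbit_boundary_of_finite_measure {G X : Type*} [Group G]
    [TopologicalSpace G] [IsTopologicalGroup G] [MetricSpace X] (hX : IsCATNegOne X)
    {Γ : Subgroup G} [MeasurableSpace (G ⧸ Γ)] [BorelSpace (G ⧸ Γ)] (μ : Measure (G ⧸ Γ))
    [IsFiniteMeasure μ] [SMulInvariantMeasure G (G ⧸ Γ) μ] (hμ : μ ≠ 0)
    {ρ : G →* (X ≃ᵢ X)} (hρ : IsNonElementary ρ) (ξ : GromovBoundary X) :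
    (Set.range fun γ : Γ => GromovBoundary.map (ρ γ) ξ).Infinite := by
  intro hfin
  let _ : MulAction G (GromovBoundary X) := boundaryAction ρ
  set F := Set.range fun γ : Γ => GromovBoundary.map (ρ γ) ξ with hFdef
  have hF : ∀ γ ∈ Γ, ∀ η ∈ F, γ • η ∈ F := by
    rintro γ hγ _ ⟨γ', rfl⟩
    exact ⟨⟨γ, hγ⟩ * γ', mul_smul γ (γ' : G) ξ⟩
  have hFne : F.Nonempty := ⟨_, 1, rfl⟩
  have hcont : ∀ (o : X) (η : GromovBoundary X) (n : ℕ),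
      Continuous fun g : G => boundaryRay hX o (g • η) n := fun o η n =>
    continuous_boundaryRay_map hX ρ hρ.orbitallyContinuous o η n
  have hsmul : ∀ (g : G) (o : X) (η : GromovBoundary X) (n : ℕ),
      ρ g (boundaryRay hX o η n) = boundaryRay hX (ρ g o) (g • η) n := fun g o η n =>
    map_boundaryRay hX (ρ g) o η n
  have hinv : ∀ (g : G) (A : Set (GromovBoundary X)),
      μ (hitSet Γ F {η | g • η ∈ A}) = μ (hitSet Γ F A) := fun g A => by
    rw [← preimage_smul_hitSet, measure_preimage_smul]
  have hmeas : ∀ (o v : X) (n : ℕ) (r : ℝ),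
      MeasurableSet (hitSet Γ F {η | dist (boundaryRay hX o η n) v < r}) := fun o v n r =>
    (isOpen_hitSet hF (A := {η | dist (boundaryRay hX o η n) v < r}) fun η _ =>
      isOpen_Iio.preimage ((hcont o η n).dist (continuous_const (y := v)))).measurableSet
  obtain ⟨x₀, -⟩ := Quot.exists_rep ξ
  set o : X := x₀.1 0
  have hmeas₁ : ∀ η : GromovBoundary X, MeasurableSet (hitSet Γ F {η}) := fun η => by
    refine (isClosed_hitSet hF hfin fun η' _ => ?_).measurableSet
    have : {g : G | g • η' ∈ ({η} : Set (GromovBoundary X))} =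
        ⋂ n, {g : G | boundaryRay hX o (g • η') n = boundaryRay hX o η n} := by
      ext g
      simp only [Set.mem_singleton_iff, Set.mem_ofPred_eq, Set.mem_iInter]
      exact ⟨fun h n => by rw [h], eq_of_boundaryRay_eq hX o⟩
    rw [this]
    exact isClosed_iInter fun n => isClosed_eq (hcont o η' n) continuous_const
  have hM : μ Set.univ ≠ 0 := by rwa [Ne, Measure.measure_univ_eq_zero]
  have hMtop : μ Set.univ ≠ ⊤ := measure_ne_top _ _
  set c : ENNReal := μ Set.univ / 2 / 2 with hc
  have hc0 : c ≠ 0 := by simp [hc, hM]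
  have hcc : c + c < μ Set.univ := by
    rw [hc, ENNReal.add_halves]
    exact ENNReal.half_lt_self hM hMtop
  -- The points from which no direction, at distance `n`, carries more than a quarter of the mass.
  set T : ℕ → Set X := fun n =>
    {x | ∀ v, μ (hitSet Γ F {η | dist (boundaryRay hX x η n) v < 1}) ≤ c} with hT
  have hTne : ∃ n, (T n).Nonempty := by
    by_contra! hempty
    have hbad : ∀ n, ∃ v, c < μ (hitSet Γ F {η | dist (boundaryRay hX o η n) v < 1}) := fun n => by
      by_contra! h
      have : o ∈ T n := h
      rw [hempty n] at this
      exact this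
    choose v hv using hbad
    obtain ⟨ζ, hζ⟩ := exists_le_measure_hitSet_singleton hF hfin hc0
      (fun n => {η | dist (boundaryRay hX o η n) (v n) < 1})
      (fun n ζ => {η | dist (boundaryRay hX o η n) (boundaryRay hX o ζ n) < 2})
      (fun n => hmeas _ _ _ _) (fun n => (hv n).le) (fun n ζ => hmeas _ _ _ _)
      (fun ζ m n hmn η hη => (dist_boundaryRay_mono hX o η ζ hmn).trans_lt hη)
      (fun ζ η h => eq_of_dist_boundaryRay_lt hX o h)
      (fun n ζ hζ η hη => by
        have h1 : dist (boundaryRay hX o ζ n) (v n) < 1 := hζ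
        have h2 : dist (boundaryRay hX o η n) (v n) < 1 := hη
        have h3 := dist_triangle_right (boundaryRay hX o η n) (boundaryRay hX o ζ n) (v n)
        change dist (boundaryRay hX o η n) (boundaryRay hX o ζ n) < 2
        linarith)
    -- The atoms of mass at least `c` form a finite invariant set.
    refine hρ.infinite_orbit_boundary ζ
      ((finite_setOf_le_measure_hitSet (μ := μ) hF hfin hmeas₁ hc0).subset ?_)
    rintro _ ⟨g, rfl⟩
    change c ≤ μ (hitSet Γ F {g • ζ})
    rw [← hinv g]
    convert hζ using 3
    ext η
    simp
  obtain ⟨n, hn⟩ := hTne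
  have hTb : Bornology.IsBounded (T n) := by
    obtain ⟨L, hL⟩ := exists_shadow_cover hX n
    refine Metric.isBounded_iff.2 ⟨L, fun x hx x' hx' => ?_⟩
    by_contra! hfar
    refine absurd hcc (not_lt.2 ?_)
    calc μ Set.univ = μ (hitSet Γ F Set.univ) := by rw [hitSet_univ hFne]
      _ ≤ μ (hitSet Γ F ({η | dist (boundaryRay hX x η n) (geod hX x x' n) < 1} ∪
            {η | dist (boundaryRay hX x' η n) (geod hX x' x n) < 1})) :=
          measure_mono (hitSet_mono fun η _ => hL x x' hfar.le η)
      _ ≤ _ := (measure_mono (hitSet_union _ _)).trans (measure_union_le _ _)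
      _ ≤ c + c := add_le_add (hx _) (hx' _)
  obtain ⟨p, hp⟩ := hX.exists_forall_fixed hn hTb
  have hpfix : ∀ g : G, ρ g p = p := fun g => by
    refine hp (ρ g) fun x hx v => ?_
    have e : (ρ g).symm = ρ g⁻¹ := (map_inv ρ g).symm
    rw [e, ← hinv g⁻¹]
    refine le_trans (le_of_eq ?_) (hx (ρ g v))
    congr 2
    ext η
    have e' : v = ρ g⁻¹ (ρ g v) := by rw [← e, (ρ g).symm_apply_apply]
    simp only [Set.mem_ofPred_eq]
    rw [← hsmul]
    nth_rewrite 1 [e']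
    rw [(ρ g⁻¹).dist_eq]
  refine hρ.infinite_orbit p ((Set.finite_singleton p).subset ?_)
  rintro _ ⟨g, rfl⟩
  exact hpfix g

theorem mainTheorem4 {G X : Type*} [Group G] [TopologicalSpace G] [IsTopologicalGroup G]
    [T2Space G] [LocallyCompactSpace G] [SigmaCompactSpace G] [MetricSpace X]
    (hX : IsCATNegOne X) (Γ : Subgroup G) (hΓ : IsLatticeSubgroup Γ)
    (ρ : G →* (X ≃ᵢ X)) (hρ : IsNonElementary ρ)
    (hfix : ¬ ∃ x : X, ∀ γ ∈ Γ, ρ γ x = x) :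
    IsNonElementary (ρ.comp Γ.subtype) := by
  refine ⟨fun x => (hρ.orbitallyContinuous x).comp continuous_subtype_val, fun x hfin => hfix ?_,
    fun ξ => ?_⟩
  · obtain ⟨p, hp⟩ := hX.exists_forall_fixed ⟨_, Set.mem_range_self 1⟩ hfin.isBounded
    refine ⟨p, fun γ hγ => hp (ρ γ) ?_⟩
    rintro _ ⟨γ', rfl⟩
    have e : (ρ γ).symm = ρ γ⁻¹ := (map_inv ρ γ).symm
    refine ⟨⟨γ, hγ⟩⁻¹ * γ', ?_⟩
    rw [e]
    change ρ (γ⁻¹ * γ') x = ρ γ⁻¹ (ρ γ' x)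
    rw [map_mul, IsometryEquiv.mul_apply]
  · obtain ⟨-, μ, hμ, hμfin, -, hμinv⟩ := hΓ
    let _ : MeasurableSpace (G ⧸ Γ) := borel (G ⧸ Γ)
    have : BorelSpace (G ⧸ Γ) := ⟨rfl⟩
    exact hρ.infinite_orbit_boundary_of_finite_measure hX μ hμ ξ
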